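/- Work on $\mathbb{C}^4\otimes\mathbb{C}^4$ with orthonormal basis $|k\rangle\otimes|l\rangle$, $k,l\in\{0,1,2,3\}$. A Hermitian operator $W$ is an entanglement witness (EW) if $\langle\psi\otimes\phi|W|\psi\otimes\phi\rangle\ge 0$ for all $\psi,\phi\in\mathbb{C}^4$ and $W$ is not positive semidefinite. Let $\mathcal{D}_W=\{\rho\ge 0:\ \mathrm{Tr}\,\rho=1,\ \mathrm{Tr}(W\rho)<0\}$ be the set of states detected by $W$; an EW $W$ is optimal if there is no EW $W'$ with $\mathcal{D}_W\subsetneq\mathcal{D}_{W'}$. An EW has the spanning property if the product vectors $\psi\otimes\phi$ with $\langle\psi\otimes\phi|W|\psi\otimes\phi\rangle=0$ span $\mathbb{C}^4\otimes\mathbb{C}^4$. For $\theta\in(0,\pi)$ put $a=\tfrac12(1+\cos\theta)$, $b=\tfrac12(2-\sin\theta)$, $c=1-a$, $d=2-b$, $$A=\begin{pmatrix}a&b&c&d\\ d&a&b&c\\ c&d&a&b\\ b&c&d&a\end{pmatrix},\qquad W_{II}(\theta)=\sum_{k,l=0}^{3}A_{kl}\,|k\rangle\langle k|\otimes|l\rangle\langle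 l|-\sum_{k\neq l}|k\rangle\langle l|\otimes|k\rangle\langle l| .$$ Theorem. For every $\theta\in(0,\pi)$, $W_{II}(\theta)$ is an optimal entanglement witness. The product vectors on which its expectation value vanishes span a subspace of dimension exactly $14$, so $W_{II}(\theta)$ does not have the spanning property. Moreover, no nonzero positive semidefinite operator can be subtracted from it: for every positive semidefinite $P\neq 0$ (in particular, for every nonzero positive rank-one operator supported on the orthogonal complement of that 14-dimensional subspace), $W_{II}(\theta)-P$ is not an entanglement witness. -/

import Mathlib

open scoped Kronecker ComplexOrder

/-- The product vector `ψ ⊗ φ` of `ℂᵐ ⊗ ℂⁿ`, in coordinates. -/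
def productVector {m n : Type*} (ψ : m → ℂ) (φ : n → ℂ) : m × n → ℂ :=
  fun p => ψ p.1 * φ p.2

/-- The expectation value `⟨v|W|v⟩`. -/
def expectation {ι : Type*} [Fintype ι] (W : Matrix ι ι ℂ) (v : ι → ℂ) : ℂ :=
  dotProduct (star v) (W.mulVec v)

/-- An entanglement witness on `ℂᵐ ⊗ ℂⁿ`: a Hermitian operator, nonnegative on product vectors
(its expectation values are real), that is not a positive operator. -/
def IsEntanglementWitness {m n : Type*} [Fintype m] [Fintype n]
    (W : Matrix (m × n) (m × n) ℂ) : Prop :=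
  W.IsHermitian ∧
    (∀ (ψ : m → ℂ) (φ : n → ℂ), 0 ≤ (expectation W (productVector ψ φ)).re) ∧
    ¬ W.PosSemidef

/-- A density operator: positive semidefinite of trace one. -/
def IsDensityOperator {ι : Type*} [Fintype ι] (ρ : Matrix ι ι ℂ) : Prop :=
  ρ.PosSemidef ∧ ρ.trace = 1

/-- The set of states `ρ` detected by `W`, that is, with `Tr (W ρ) < 0`
(the trace is real for Hermitian `W`). -/
def detectedStates {ι : Type*} [Fintype ι] (W : Matrix ι ι ℂ) : Set (Matrix ι ι ℂ) :=
  {ρ | IsDensityOperator ρ ∧ (W * ρ).trace.re < 0}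

/-- An optimal entanglement witness: no entanglement witness detects
a strictly larger set of states. -/
def IsOptimalEntanglementWitness {m n : Type*} [Fintype m] [Fintype n]
    (W : Matrix (m × n) (m × n) ℂ) : Prop :=
  IsEntanglementWitness W ∧
    ∀ W' : Matrix (m × n) (m × n) ℂ, IsEntanglementWitness W' →
      ¬ (detectedStates W ⊂ detectedStates W')

/-- The product vectors on which the expectation value of `W` vanishes. -/
def zeroProductVectors {m n : Type*} [Fintype m] [Fintype n]
    (W : Matrix (m × n) (m × n) ℂ) : Set (m × n → ℂ) :=
  {v | ∃ (ψ : m → ℂ) (φ : n → ℂ), v = productVector ψ φ ∧ expectation W v = 0}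

/-- The spanning property: the product vectors of zero expectation value span the whole space. -/
def HasSpanningProperty {m n : Type*} [Fintype m] [Fintype n]
    (W : Matrix (m × n) (m × n) ℂ) : Prop :=
  Submodule.span ℂ (zeroProductVectors W) = ⊤

/-- The circulant matrix with first row `(a, b, c, d)`. -/
def circulantA (a b c d : ℝ) : Matrix (Fin 4) (Fin 4) ℝ :=
  !![a, b, c, d;
     d, a, b, c;
     c, d, a, b;
     b, c, d, a]

/-- The operator `W[a,b,c,d] = ∑ A_{kl} |k⟩⟨k| ⊗ |l⟩⟨l| - ∑_{k ≠ l} |k⟩⟨l| ⊗ |k⟩⟨l|`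
on `ℂ⁴ ⊗ ℂ⁴`, where `A` is the circulant matrix of `a, b, c, d`. -/
noncomputable def circulantOperator (a b c d : ℝ) :
    Matrix (Fin 4 × Fin 4) (Fin 4 × Fin 4) ℂ :=
  (∑ k : Fin 4, ∑ l : Fin 4,
      ((circulantA a b c d k l : ℝ) : ℂ) •
        (Matrix.single k k (1 : ℂ) ⊗ₖ Matrix.single l l (1 : ℂ))) -
    ∑ k : Fin 4, ∑ l ∈ Finset.univ.filter (fun l : Fin 4 => k ≠ l),
      Matrix.single k l (1 : ℂ) ⊗ₖ Matrix.single k l (1 : ℂ)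

/-- The class-II operator `W_II(θ)`:
`a = (1 + cos θ)/2`, `b = (2 - sin θ)/2`, `c = 1 - a`, `d = 2 - b`. -/
noncomputable def classIIWitness (θ : ℝ) : Matrix (Fin 4 × Fin 4) (Fin 4 × Fin 4) ℂ :=
  circulantOperator ((1 + Real.cos θ) / 2) ((2 - Real.sin θ) / 2)
    (1 - (1 + Real.cos θ) / 2) (2 - (2 - Real.sin θ) / 2)

/-! Put `S = sin θ / 2`; then (a, b, c, d) = (a, 1 - S, 1 - a, 1 + S) with S² = a(1 - a). On ψ ⊗ φ
the expectation value is ∑ |ψ_k|² w_k - |∑ ψ_k φ_k|², where w_k is linear in y_l = |φ_l|². By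
weighted Cauchy–Schwarz, nonnegativity reduces to ∑ y_k / w_k ≤ 1. The relation S² = a(1 - a) makes
the defect a sum of nonnegative terms (`prod_mul_one_sub_sum_div`), which vanishes only if y_0 = y_2
and y_1 = y_3. A nonzero product vector of zero expectation then has ψ proportional to the conjugate
of φ, hence v_00 = v_22 and v_11 = v_33. Conversely, zeros of the form ψ ⊗ ψ̄ already span this
14-dimensional space (`span_zeroProductVectors`).

If P ≥ 0 can be subtracted, P annihilates every zero, so only its entries on e_00 and e_11 remain
undetermined. They are reached by approximate zeros (`exists_productVector_expectation_le`): their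
expectation is O(δ³), while modulo the span they equal δ e_11 + O(δ²) e_00. Thus δ² P_{11,11} ≤
O(δ³), so P_{11,11} = 0; the cyclic symmetry gives P_{00,00} = 0, and P = 0.

Optimality follows: if W' detects every state detected by W, then cW - W' ≥ 0 for some c > 0, so W -
W'/c is a subtractable positive operator and must vanish. -/

/-! ### The cyclic inequality -/

/-- The denominators `w_k = y_k + ∑ A_{kl} y_l` of the cyclic inequality. -/
noncomputable def cyclicWeight (a S : ℝ) (y : Fin 4 → ℝ) (k : Fin 4) : ℝ :=
  ∑ l, circulantA a (1 - S) (1 - a) (1 + S) k l * y l + y k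

theorem cyclicWeight_zero (a S : ℝ) (y : Fin 4 → ℝ) :
    cyclicWeight a S y 0 = (1 + a) * y 0 + (1 - S) * y 1 + (1 - a) * y 2 + (1 + S) * y 3 := by
  simp [cyclicWeight, circulantA, Fin.sum_univ_four]; ring

theorem cyclicWeight_one (a S : ℝ) (y : Fin 4 → ℝ) :
    cyclicWeight a S y 1 = (1 + S) * y 0 + (1 + a) * y 1 + (1 - S) * y 2 + (1 - a) * y 3 := by
  simp [cyclicWeight, circulantA, Fin.sum_univ_four]; ring

theorem cyclicWeight_two (a S : ℝ) (y : Fin 4 → ℝ) :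
    cyclicWeight a S y 2 = (1 - a) * y 0 + (1 + S) * y 1 + (1 + a) * y 2 + (1 - S) * y 3 := by
  simp [cyclicWeight, circulantA, Fin.sum_univ_four]; ring

theorem cyclicWeight_three (a S : ℝ) (y : Fin 4 → ℝ) :
    cyclicWeight a S y 3 = (1 - S) * y 0 + (1 - a) * y 1 + (1 + S) * y 2 + (1 + a) * y 3 := by
  simp [cyclicWeight, circulantA, Fin.sum_univ_four]; ring

theorem cyclicWeight_pos {a S : ℝ} (ha : 0 < a) (ha1 : a < 1) (hS : 0 < S) (hS1 : S < 1)
    {y : Fin 4 → ℝ} (hy : ∀ k, 0 ≤ y k) (hy0 : y ≠ 0) (k : Fin 4) :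
    0 < cyclicWeight a S y k := by
  obtain ⟨l, hl⟩ : ∃ l, 0 < y l := by
    by_contra! h
    exact hy0 (funext fun l => le_antisymm (h l) (hy l))
  have hA : ∀ i j, 0 < circulantA a (1 - S) (1 - a) (1 + S) i j := by
    intro i j
    fin_cases i <;> fin_cases j <;> simp [circulantA] <;> linarith
  have h1 : 0 < ∑ l, circulantA a (1 - S) (1 - a) (1 + S) k l * y l :=
    Finset.sum_pos' (fun i _ => mul_nonneg (hA k i).le (hy i))
      ⟨l, Finset.mem_univ _, mul_pos (hA k l) hl⟩
  exact add_pos_of_pos_of_nonneg h1 (hy k)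

/-- The defect in the cyclic inequality, as a sum of nonnegative terms. -/
theorem prod_mul_one_sub_sum_div {a S : ℝ} (hSa : S ^ 2 = a * (1 - a)) {y : Fin 4 → ℝ}
    (hw : ∀ k, cyclicWeight a S y k ≠ 0) {s t u v m n : ℝ} (hs : s = y 0 + y 2)
    (ht : t = y 1 + y 3) (hu : u = y 0 - y 2) (hv : v = y 1 - y 3) (hm : m = a * u - S * v)
    (hn : n = a * v + S * u) :
    (∏ k, cyclicWeight a S y k) * (1 - ∑ k, y k / cyclicWeight a S y k) =
      m ^ 2 * (t * (s + t) - n * v) + n ^ 2 * (s * (s + t) - m * u) + m ^ 2 * n ^ 2 := by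
  have h0 : cyclicWeight a S y 0 = s + t + m := by
    rw [cyclicWeight_zero]; subst hm hn hs ht hu hv; ring
  have h1 : cyclicWeight a S y 1 = s + t + n := by
    rw [cyclicWeight_one]; subst hm hn hs ht hu hv; ring
  have h2 : cyclicWeight a S y 2 = s + t - m := by
    rw [cyclicWeight_two]; subst hm hn hs ht hu hv; ring
  have h3 : cyclicWeight a S y 3 = s + t - n := by
    rw [cyclicWeight_three]; subst hm hn hs ht hu hv; ring
  -- Since a² + S² = a, the map (u, v) ↦ (m, n) is √a times a rotation. This relation cancels the
  -- terms of the expanded defect that carry the factor (s + t)².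
  have hR : m * u + n * v = m ^ 2 + n ^ 2 := by
    rw [hm, hn]; linear_combination (-(u ^ 2 + v ^ 2)) * hSa
  have e0 : y 0 = (s + u) / 2 := by rw [hs, hu]; ring
  have e1 : y 1 = (t + v) / 2 := by rw [ht, hv]; ring
  have e2 : y 2 = (s - u) / 2 := by rw [hs, hu]; ring
  have e3 : y 3 = (t - v) / 2 := by rw [ht, hv]; ring
  have w0 := hw 0
  have w1 := hw 1
  have w2 := hw 2
  have w3 := hw 3
  rw [h0] at w0; rw [h1] at w1; rw [h2] at w2; rw [h3] at w3
  rw [Fin.prod_univ_four, Fin.sum_univ_four, h0, h1, h2, h3, e0, e1, e2, e3]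
  clear e0 e1 e2 e3 h0 h1 h2 h3 hw hs ht hu hv hm hn
  field_simp
  linear_combination 2 * (s + t) ^ 2 * hR

theorem nonneg_weighted_sub_mul_of_abs_le {s t m n u v : ℝ} (hu : |u| ≤ s) (hv : |v| ≤ t)
    (hm : |m| ≤ s + t) (hn : |n| ≤ s + t) :
    0 ≤ t * (s + t) - n * v ∧ 0 ≤ s * (s + t) - m * u := by
  have h1 : n * v ≤ (s + t) * t :=
    (le_abs_self _).trans (by
      rw [abs_mul]; exact mul_le_mul hn hv (abs_nonneg _) ((abs_nonneg _).trans hn))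
  have h2 : m * u ≤ (s + t) * s :=
    (le_abs_self _).trans (by
      rw [abs_mul]; exact mul_le_mul hm hu (abs_nonneg _) ((abs_nonneg _).trans hm))
  constructor <;> linarith

/-- All three terms of the defect are nonnegative. At equality each vanishes, which forces m = n =
0, and (u, v) ↦ (m, n) is invertible. -/
theorem sum_div_cyclicWeight_le_one {a S : ℝ} (ha : 0 < a) (ha1 : a < 1) (hS : 0 < S)
    (hS1 : S < 1) (hSa : S ^ 2 = a * (1 - a)) {y : Fin 4 → ℝ} (hy : ∀ k, 0 ≤ y k) (hy0 : y ≠ 0) :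
    ∑ k, y k / cyclicWeight a S y k ≤ 1 ∧
      (∑ k, y k / cyclicWeight a S y k = 1 → y 0 = y 2 ∧ y 1 = y 3) := by
  have hw := cyclicWeight_pos ha ha1 hS hS1 hy hy0
  have key := prod_mul_one_sub_sum_div hSa (fun k => (hw k).ne') rfl rfl rfl rfl rfl rfl
  have hP : 0 < ∏ k, cyclicWeight a S y k := Finset.prod_pos fun k _ => hw k
  have w0 := hw 0
  have w1 := hw 1
  have w2 := hw 2
  have w3 := hw 3
  rw [cyclicWeight_zero] at w0
  rw [cyclicWeight_one] at w1
  rw [cyclicWeight_two] at w2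
  rw [cyclicWeight_three] at w3
  have y0 := hy 0
  have y1 := hy 1
  have y2 := hy 2
  have y3 := hy 3
  obtain ⟨hu, hv, hm, hn⟩ : |y 0 - y 2| ≤ y 0 + y 2 ∧ |y 1 - y 3| ≤ y 1 + y 3 ∧
      |a * (y 0 - y 2) - S * (y 1 - y 3)| < (y 0 + y 2) + (y 1 + y 3) ∧
      |a * (y 1 - y 3) + S * (y 0 - y 2)| < (y 0 + y 2) + (y 1 + y 3) := by
    refine ⟨?_, ?_, ?_, ?_⟩ <;> simp only [abs_le, abs_lt] <;> constructor <;> linarith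
  obtain ⟨h1, h2⟩ := nonneg_weighted_sub_mul_of_abs_le hu hv hm.le hn.le
  generalize hs : y 0 + y 2 = s at *
  generalize ht : y 1 + y 3 = t at *
  generalize hu' : y 0 - y 2 = u at *
  generalize hv' : y 1 - y 3 = v at *
  generalize hm' : a * u - S * v = m at *
  generalize hn' : a * v + S * u = n at *
  have t1 : 0 ≤ m ^ 2 * (t * (s + t) - n * v) := mul_nonneg (sq_nonneg _) h1
  have t2 : 0 ≤ n ^ 2 * (s * (s + t) - m * u) := mul_nonneg (sq_nonneg _) h2
  have t3 : 0 ≤ m ^ 2 * n ^ 2 := by positivity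
  constructor
  · have : 0 ≤ 1 - ∑ k, y k / cyclicWeight a S y k :=
      nonneg_of_mul_nonneg_right (by rw [key]; positivity) hP
    linarith
  · intro hG
    rw [hG, sub_self, mul_zero] at key
    have hN : 0 < s + t := lt_of_le_of_lt (abs_nonneg _) hm
    -- One of m, n vanishes, say m. Then n² s (s + t) = 0; if s = 0, then u = 0 because |u| ≤ s, and
    -- m = -S v = 0 gives v = 0, so n = 0 as well.
    have hmn : m = 0 ∧ n = 0 := by
      have z3 : m ^ 2 * n ^ 2 = 0 := by linarith
      have z1 : m ^ 2 * (t * (s + t) - n * v) = 0 := by linarith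
      have z2 : n ^ 2 * (s * (s + t) - m * u) = 0 := by linarith
      rcases mul_eq_zero.1 z3 with h | h
      · have hm0 : m = 0 := by simpa using h
        refine ⟨hm0, ?_⟩
        rcases mul_eq_zero.1 z2 with h | h
        · simpa using h
        · have hs0 : s = 0 := by
            rw [hm0, zero_mul, sub_zero] at h
            exact (mul_eq_zero.1 h).resolve_right hN.ne'
          have hu0 : u = 0 := abs_nonpos_iff.1 (hs0 ▸ hu)
          rw [hu0, hm0, mul_zero, zero_sub, neg_eq_zero] at hm'
          rw [← hn', hu0, (mul_eq_zero.1 hm').resolve_left hS.ne']; ring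
      · have hn0 : n = 0 := by simpa using h
        refine ⟨?_, hn0⟩
        rcases mul_eq_zero.1 z1 with h | h
        · simpa using h
        · have ht0 : t = 0 := by
            rw [hn0, zero_mul, sub_zero] at h
            exact (mul_eq_zero.1 h).resolve_right hN.ne'
          have hv0 : v = 0 := abs_nonpos_iff.1 (ht0 ▸ hv)
          rw [hv0, hn0, mul_zero, zero_add] at hn'
          rw [← hm', hv0, (mul_eq_zero.1 hn').resolve_left hS.ne']; ring
    obtain ⟨hm0, hn0⟩ := hmn
    have hu0 : a * u = 0 := by
      linear_combination a * hm' + S * hn' + a * hm0 + S * hn0 - u * hSa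
    have hv0 : a * v = 0 := by
      linear_combination a * hn' - S * hm' + a * hn0 - S * hm0 - v * hSa
    have := (mul_eq_zero.1 hu0).resolve_left ha.ne'
    have := (mul_eq_zero.1 hv0).resolve_left ha.ne'
    constructor <;> linarith

/-! ### The expectation value -/

/-- Including the terms k = l completes the off-diagonal sum to the rank-one operator of ∑ |kk⟩; the
compensating 1 joins the diagonal. It is also the source of the extra y_k in `cyclicWeight`. -/
theorem circulantOperator_apply (a b c d : ℝ) (p q : Fin 4 × Fin 4) :
    circulantOperator a b c d p q =
      (if p = q then ((circulantA a b c d p.1 p.2 + if p.1 = p.2 then 1 else 0 : ℝ) : ℂ) else 0) -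
        if p.1 = p.2 ∧ q.1 = q.2 then 1 else 0 := by
  obtain ⟨i, j⟩ := p
  obtain ⟨k, l⟩ := q
  simp only [circulantOperator, Matrix.sub_apply, Matrix.sum_apply, Matrix.smul_apply,
    Matrix.kroneckerMap_apply, Matrix.single_apply, ite_and, mul_ite,
    mul_one, mul_zero, smul_eq_mul, Finset.sum_ite_eq',
    Finset.mem_univ, if_true, Prod.mk.injEq]
  by_cases hij : i = j <;> by_cases hkl : k = l <;> by_cases hik : i = k <;>
    by_cases hjl : j = l <;> simp_all
  all_goals grind

theorem expectation_circulantOperator (a b c d : ℝ) (v : Fin 4 × Fin 4 → ℂ) :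
    expectation (circulantOperator a b c d) v =
      ((∑ k, ∑ l, circulantA a b c d k l * Complex.normSq (v (k, l)) +
        ∑ k, Complex.normSq (v (k, k)) - Complex.normSq (∑ k, v (k, k)) : ℝ) : ℂ) := by
  simp only [expectation, dotProduct, Matrix.mulVec, circulantOperator_apply, Pi.star_apply,
    sub_mul, ite_mul, zero_mul, Finset.sum_sub_distrib, Finset.sum_ite_eq, Finset.mem_univ, if_true,
    mul_sub, one_mul, Fintype.sum_prod_type]
  push_cast
  simp only [Complex.normSq_eq_conj_mul_self]
  simp [Fin.sum_univ_four]
  ring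

theorem expectation_productVector (a S : ℝ) (ψ φ : Fin 4 → ℂ) :
    expectation (circulantOperator a (1 - S) (1 - a) (1 + S)) (productVector ψ φ) =
      ((∑ k, Complex.normSq (ψ k) * cyclicWeight a S (fun l => Complex.normSq (φ l)) k -
        Complex.normSq (∑ k, ψ k * φ k) : ℝ) : ℂ) := by
  rw [expectation_circulantOperator]
  simp only [productVector, Complex.normSq_mul, cyclicWeight, mul_add, Finset.sum_add_distrib,
    Finset.mul_sum]
  simp only [mul_left_comm]

/-- Cauchy–Schwarz with weights w_k. It bounds the expectation value below by (∑ |ψ_k|² w_k)(1 - ∑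
y_k / w_k). -/
theorem normSq_sum_mul_le_sum_mul_sum_div {ι : Type*} [Fintype ι] (ψ φ : ι → ℂ) {w : ι → ℝ}
    (hw : ∀ k, 0 < w k) :
    Complex.normSq (∑ k, ψ k * φ k) ≤
      (∑ k, Complex.normSq (ψ k) * w k) * ∑ k, Complex.normSq (φ k) / w k := by
  calc Complex.normSq (∑ k, ψ k * φ k) = ‖∑ k, ψ k * φ k‖ ^ 2 := Complex.normSq_eq_norm_sq _
    _ ≤ (∑ k, ‖ψ k * φ k‖) ^ 2 := by gcongr; exact norm_sum_le _ _
    _ ≤ _ := by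
      apply Finset.sum_sq_le_sum_mul_sum_of_sq_le_mul
      · exact fun k _ => mul_nonneg (Complex.normSq_nonneg _) (hw k).le
      · exact fun k _ => div_nonneg (Complex.normSq_nonneg _) (hw k).le
      · intro k _
        have := (hw k).ne'
        rw [norm_mul, Complex.normSq_eq_norm_sq, Complex.normSq_eq_norm_sq]
        exact le_of_eq (by field_simp)

/-- The expectation value of the circulant operator on a product vector is nonnegative. -/
theorem expectation_productVector_nonneg {a S : ℝ} (ha : 0 < a) (ha1 : a < 1) (hS : 0 < S)
    (hS1 : S < 1) (hSa : S ^ 2 = a * (1 - a)) (ψ φ : Fin 4 → ℂ) :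
    0 ≤ (expectation (circulantOperator a (1 - S) (1 - a) (1 + S)) (productVector ψ φ)).re := by
  rw [expectation_productVector, Complex.ofReal_re]
  by_cases hφ : φ = 0
  · simp [hφ, cyclicWeight]
  have hy : ∀ k, 0 ≤ Complex.normSq (φ k) := fun k => Complex.normSq_nonneg _
  have hy0 : (fun l => Complex.normSq (φ l)) ≠ 0 := fun h =>
    hφ (funext fun l => Complex.normSq_eq_zero.1 (congrFun h l))
  have hw := cyclicWeight_pos ha ha1 hS hS1 hy hy0
  have h1 := normSq_sum_mul_le_sum_mul_sum_div ψ φ hw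
  have h2 := (sum_div_cyclicWeight_le_one ha ha1 hS hS1 hSa hy hy0).1
  have h3 : 0 ≤ ∑ k, Complex.normSq (ψ k) * cyclicWeight a S (fun l => Complex.normSq (φ l)) k :=
    Finset.sum_nonneg fun k _ => mul_nonneg (Complex.normSq_nonneg _) (hw k).le
  nlinarith

/-- At a zero with φ ≠ 0 all weights equal ∑ |φ_l|², so the expectation value becomes this
Cauchy–Schwarz defect and every minor must vanish. The conjugates fall on φ because the pairing ∑
ψ_k φ_k is bilinear. -/
theorem lagrange_identity_fin_four (ψ φ : Fin 4 → ℂ) :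
    (∑ k, Complex.normSq (ψ k)) * (∑ k, Complex.normSq (φ k)) -
        Complex.normSq (∑ k, ψ k * φ k) =
      Complex.normSq (ψ 0 * star (φ 1) - ψ 1 * star (φ 0)) +
      Complex.normSq (ψ 0 * star (φ 2) - ψ 2 * star (φ 0)) +
      Complex.normSq (ψ 0 * star (φ 3) - ψ 3 * star (φ 0)) +
      Complex.normSq (ψ 1 * star (φ 2) - ψ 2 * star (φ 1)) +
      Complex.normSq (ψ 1 * star (φ 3) - ψ 3 * star (φ 1)) +
      Complex.normSq (ψ 2 * star (φ 3) - ψ 3 * star (φ 2)) := by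
  apply Complex.ofReal_injective
  push_cast
  simp only [Complex.normSq_eq_conj_mul_self, Fin.sum_univ_four, map_add, map_sub, map_mul,
    Complex.star_def, Complex.conj_conj]
  ring

theorem mul_eq_mul_of_mul_star_eq {x y z w : ℂ} (h : x * star w - y * star z = 0)
    (hn : Complex.normSq z = Complex.normSq w) : x * z = y * w := by
  by_cases hz : z = 0
  · have hw : w = 0 := by
      rw [hz, map_zero] at hn
      exact Complex.normSq_eq_zero.1 hn.symm
    simp [hz, hw]
  · have h1 : star z ≠ 0 := star_ne_zero.2 hz
    have h2 : star z * z = star w * w := by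
      have := congrArg (fun r : ℝ => (r : ℂ)) hn
      simpa only [Complex.normSq_eq_conj_mul_self, Complex.star_def] using this
    have h3 : star z * (x * z - y * w) = 0 := by linear_combination w * h + x * h2
    exact sub_eq_zero.1 ((mul_eq_zero.1 h3).resolve_left h1)

/-- A product vector of zero expectation value has two pairs of equal diagonal coordinates. -/
theorem eq_of_expectation_productVector_eq_zero {a S : ℝ} (ha : 0 < a) (ha1 : a < 1) (hS : 0 < S)
    (hS1 : S < 1) (hSa : S ^ 2 = a * (1 - a)) (ψ φ : Fin 4 → ℂ)
    (h : expectation (circulantOperator a (1 - S) (1 - a) (1 + S)) (productVector ψ φ) = 0) :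
    ψ 0 * φ 0 = ψ 2 * φ 2 ∧ ψ 1 * φ 1 = ψ 3 * φ 3 := by
  rw [expectation_productVector, Complex.ofReal_eq_zero] at h
  by_cases hφ : φ = 0
  · simp [hφ]
  by_cases hψ : ψ = 0
  · simp [hψ]
  have hy : ∀ k, 0 ≤ Complex.normSq (φ k) := fun k => Complex.normSq_nonneg _
  have hy0 : (fun l => Complex.normSq (φ l)) ≠ 0 := fun h =>
    hφ (funext fun l => Complex.normSq_eq_zero.1 (congrFun h l))
  have hw := cyclicWeight_pos ha ha1 hS hS1 hy hy0
  have h1 := normSq_sum_mul_le_sum_mul_sum_div ψ φ hw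
  obtain ⟨h2, h2'⟩ := sum_div_cyclicWeight_le_one ha ha1 hS hS1 hSa hy hy0
  obtain ⟨j, hj⟩ := Function.ne_iff.1 hψ
  have h3 : 0 < ∑ k, Complex.normSq (ψ k) * cyclicWeight a S (fun l => Complex.normSq (φ l)) k :=
    Finset.sum_pos' (fun k _ => mul_nonneg (Complex.normSq_nonneg _) (hw k).le)
      ⟨j, Finset.mem_univ _, mul_pos (Complex.normSq_pos.2 hj) (hw j)⟩
  -- A strict cyclic inequality would make the expectation value positive, as the factor ∑ |ψ_k|²
  -- w_k is positive.
  obtain ⟨e1, e2⟩ := h2' (by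
    apply le_antisymm h2
    by_contra! hlt
    nlinarith)
  -- With y of period two, the coefficients pair up as (1 + a) + (1 - a) = 2 and (1 - S) + (1 + S) =
  -- 2.
  have hc : ∀ k, cyclicWeight a S (fun l => Complex.normSq (φ l)) k =
      ∑ l, Complex.normSq (φ l) := by
    simp only [Fin.forall_fin_succ, Fin.sum_univ_four]
    simp only [Fin.succ_zero_eq_one, Fin.succ_one_eq_two, IsEmpty.forall_iff, and_true]
    refine ⟨?_, ?_, ?_, ?_⟩
    · rw [cyclicWeight_zero, ← e1, ← e2]; ring
    · rw [cyclicWeight_one, ← e1, ← e2]; ring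
    · rw [cyclicWeight_two, ← e1, ← e2]; ring
    · exact (cyclicWeight_three _ _ _).trans (by rw [← e1, ← e2]; ring)
  simp only [hc, ← Finset.sum_mul] at h
  rw [lagrange_identity_fin_four] at h
  have n1 := Complex.normSq_nonneg (ψ 0 * star (φ 1) - ψ 1 * star (φ 0))
  have n2 := Complex.normSq_nonneg (ψ 0 * star (φ 2) - ψ 2 * star (φ 0))
  have n3 := Complex.normSq_nonneg (ψ 0 * star (φ 3) - ψ 3 * star (φ 0))
  have n4 := Complex.normSq_nonneg (ψ 1 * star (φ 2) - ψ 2 * star (φ 1))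
  have n5 := Complex.normSq_nonneg (ψ 1 * star (φ 3) - ψ 3 * star (φ 1))
  have n6 := Complex.normSq_nonneg (ψ 2 * star (φ 3) - ψ 3 * star (φ 2))
  exact ⟨mul_eq_mul_of_mul_star_eq (Complex.normSq_eq_zero.1 (by linarith)) e1,
    mul_eq_mul_of_mul_star_eq (Complex.normSq_eq_zero.1 (by linarith)) e2⟩

/-! ### Zeros and the subspace they span -/

/-- For conjugate vectors with moduli of period two the expectation value vanishes. -/
theorem expectation_productVector_star_eq_zero (a S : ℝ) {ψ : Fin 4 → ℂ}
    (h0 : Complex.normSq (ψ 0) = Complex.normSq (ψ 2))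
    (h1 : Complex.normSq (ψ 1) = Complex.normSq (ψ 3)) :
    expectation (circulantOperator a (1 - S) (1 - a) (1 + S)) (productVector ψ (star ψ)) = 0 := by
  rw [expectation_productVector, Complex.ofReal_eq_zero]
  have hs : ∑ k, ψ k * star ψ k = ((∑ k, Complex.normSq (ψ k) : ℝ) : ℂ) := by
    push_cast
    exact Finset.sum_congr rfl fun k _ => Complex.mul_conj _
  have hn : (fun l => Complex.normSq (star ψ l)) = fun l => Complex.normSq (ψ l) :=
    funext fun l => Complex.normSq_conj _
  rw [hs, Complex.normSq_ofReal, hn]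
  simp only [Fin.sum_univ_four, cyclicWeight_zero, cyclicWeight_one, cyclicWeight_two,
    cyclicWeight_three, ← h0, ← h1]
  ring

/-- The two diagonal constraints satisfied by the zeros. -/
def diagonalDefect : (Fin 4 × Fin 4 → ℂ) →ₗ[ℂ] ℂ × ℂ where
  toFun v := (v (0, 0) - v (2, 2), v (1, 1) - v (3, 3))
  map_add' v w := by simp [add_sub_add_comm]
  map_smul' c v := by simp [mul_sub]

theorem mem_ker_diagonalDefect {v : Fin 4 × Fin 4 → ℂ} :
    v ∈ LinearMap.ker diagonalDefect ↔ v (0, 0) = v (2, 2) ∧ v (1, 1) = v (3, 3) := by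
  simp [diagonalDefect, sub_eq_zero]

theorem finrank_ker_diagonalDefect : Module.finrank ℂ (LinearMap.ker diagonalDefect) = 14 := by
  have hr : LinearMap.range diagonalDefect = ⊤ := by
    rw [LinearMap.range_eq_top]
    rintro ⟨x, y⟩
    exact ⟨Pi.single (0, 0) x + Pi.single (1, 1) y, by simp [diagonalDefect]⟩
  have h := LinearMap.finrank_range_add_finrank_ker diagonalDefect
  rw [hr, finrank_top] at h
  simp at h
  omega

/-- A vector of phases equal to one outside of the coordinates `k` and `l`. -/
noncomputable def phaseVector (k l : Fin 4) (x y : ℂ) : Fin 4 → ℂ :=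
  fun i => if i = k then x else if i = l then y else 1

/-- The signed sum over both phases keeps only the coordinates odd in each of them, namely (k, l)
and (l, k). -/
theorem sum_sign_productVector_phaseVector {k l : Fin 4} (hkl : k ≠ l) (x : ℂ) :
    productVector (phaseVector k l x 1) (star (phaseVector k l x 1)) -
        productVector (phaseVector k l x (-1)) (star (phaseVector k l x (-1))) -
        productVector (phaseVector k l (-x) 1) (star (phaseVector k l (-x) 1)) +
        productVector (phaseVector k l (-x) (-1)) (star (phaseVector k l (-x) (-1))) =
      (4 * x) • Pi.single (k, l) (1 : ℂ) + (4 * star x) • Pi.single (l, k) (1 : ℂ) := by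
  ext ⟨i, j⟩
  simp only [productVector, phaseVector, Pi.add_apply, Pi.sub_apply, Pi.star_apply, Pi.smul_apply,
    Pi.single_apply, Prod.mk.injEq, smul_eq_mul]
  by_cases hik : i = k <;> by_cases hil : i = l <;> by_cases hjk : j = k <;>
    by_cases hjl : j = l <;> simp_all <;> ring

/-- The phases x = 1 and x = i separate (k, l) from (l, k), whose coefficients are x and its
conjugate. -/
theorem sum_sign_combination {k l : Fin 4} :
    (4 * 1 : ℂ) • Pi.single (k, l) (1 : ℂ) + (4 * star 1 : ℂ) • Pi.single (l, k) (1 : ℂ) -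
        Complex.I • ((4 * Complex.I) • Pi.single (k, l) (1 : ℂ) +
          (4 * star Complex.I) • Pi.single (l, k) (1 : ℂ)) =
      (8 : ℂ) • (Pi.single (k, l) (1 : ℂ) : Fin 4 × Fin 4 → ℂ) := by
  have h := Complex.I_mul_I
  simp only [smul_add, smul_smul, star_one, Complex.star_def, Complex.conj_I]
  rw [show Complex.I * (4 * Complex.I) = -4 by linear_combination 4 * h,
    show Complex.I * (4 * -Complex.I) = 4 by linear_combination -4 * h]
  module

theorem productVector_star_mem_zeroProductVectors (a S : ℝ) {ψ : Fin 4 → ℂ}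
    (h0 : Complex.normSq (ψ 0) = Complex.normSq (ψ 2))
    (h1 : Complex.normSq (ψ 1) = Complex.normSq (ψ 3)) :
    productVector ψ (star ψ) ∈
      Submodule.span ℂ (zeroProductVectors (circulantOperator a (1 - S) (1 - a) (1 + S))) :=
  Submodule.subset_span ⟨_, _, rfl, expectation_productVector_star_eq_zero a S h0 h1⟩

theorem single_mem_span_zeroProductVectors (a S : ℝ) {k l : Fin 4} (hkl : k ≠ l) :
    Pi.single (k, l) 1 ∈
      Submodule.span ℂ (zeroProductVectors (circulantOperator a (1 - S) (1 - a) (1 + S))) := by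
  have hp : ∀ x y : ℂ, Complex.normSq x = 1 → Complex.normSq y = 1 →
      productVector (phaseVector k l x y) (star (phaseVector k l x y)) ∈
        Submodule.span ℂ (zeroProductVectors (circulantOperator a (1 - S) (1 - a) (1 + S))) := by
    intro x y hx hy
    have : ∀ i, Complex.normSq (phaseVector k l x y i) = 1 := by
      intro i
      unfold phaseVector
      split_ifs <;> simp [hx, hy]
    apply productVector_star_mem_zeroProductVectors <;> simp only [this]
  have hs : ∀ x : ℂ, Complex.normSq x = 1 →
      (4 * x) • Pi.single (k, l) (1 : ℂ) + (4 * star x) • Pi.single (l, k) (1 : ℂ) ∈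
        Submodule.span ℂ (zeroProductVectors (circulantOperator a (1 - S) (1 - a) (1 + S))) := by
    intro x hx
    have hx' : Complex.normSq (-x) = 1 := by rwa [Complex.normSq_neg]
    have h1 : Complex.normSq (-1) = 1 := by simp
    rw [← sum_sign_productVector_phaseVector hkl]
    exact add_mem (sub_mem (sub_mem (hp _ _ hx (map_one _)) (hp _ _ hx h1))
      (hp _ _ hx' (map_one _))) (hp _ _ hx' h1)
  have h8 := sub_mem (hs 1 (map_one _)) (Submodule.smul_mem _ Complex.I (hs Complex.I (by simp)))
  rw [sum_sign_combination] at h8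
  simpa [smul_smul] using Submodule.smul_mem _ (8⁻¹ : ℂ) h8

theorem span_zeroProductVectors {a S : ℝ} (ha : 0 < a) (ha1 : a < 1) (hS : 0 < S)
    (hS1 : S < 1) (hSa : S ^ 2 = a * (1 - a)) :
    Submodule.span ℂ (zeroProductVectors (circulantOperator a (1 - S) (1 - a) (1 + S))) =
      LinearMap.ker diagonalDefect := by
  apply le_antisymm
  · rw [Submodule.span_le]
    rintro v ⟨ψ, φ, rfl, h⟩
    rw [SetLike.mem_coe, mem_ker_diagonalDefect]
    exact eq_of_expectation_productVector_eq_zero ha ha1 hS hS1 hSa ψ φ h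
  · intro v hv
    rw [mem_ker_diagonalDefect] at hv
    have hs := fun (k l : Fin 4) (h : k ≠ l) (c : ℂ) => Submodule.smul_mem _ c
      (single_mem_span_zeroProductVectors a S h)
    have h02 := productVector_star_mem_zeroProductVectors a S (ψ := ![1, 0, 1, 0]) rfl rfl
    have h13 := productVector_star_mem_zeroProductVectors a S (ψ := ![0, 1, 0, 1]) rfl rfl
    -- The vectors (1,0,1,0) and (0,1,0,1) supply the two diagonal degrees of freedom; the entries
    -- they create at (0,2), (2,0), (1,3), (3,1) are corrected by off-diagonal units.
    have key : v =
        v (0, 0) • productVector ![1, 0, 1, 0] (star ![1, 0, 1, 0]) +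
        v (1, 1) • productVector ![0, 1, 0, 1] (star ![0, 1, 0, 1]) +
        (v (0, 1) • Pi.single (0, 1) 1 + v (1, 0) • Pi.single (1, 0) 1 +
        (v (0, 2) - v (0, 0)) • Pi.single (0, 2) 1 + (v (2, 0) - v (0, 0)) • Pi.single (2, 0) 1 +
        v (0, 3) • Pi.single (0, 3) 1 + v (3, 0) • Pi.single (3, 0) 1 +
        v (1, 2) • Pi.single (1, 2) 1 + v (2, 1) • Pi.single (2, 1) 1 +
        (v (1, 3) - v (1, 1)) • Pi.single (1, 3) 1 + (v (3, 1) - v (1, 1)) • Pi.single (3, 1) 1 +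
        v (2, 3) • Pi.single (2, 3) 1 + v (3, 2) • Pi.single (3, 2) 1) := by
      ext ⟨i, j⟩
      fin_cases i <;> fin_cases j <;> simp [productVector, hv.1, hv.2]
    rw [key]
    refine add_mem (add_mem (Submodule.smul_mem _ _ h02) (Submodule.smul_mem _ _ h13)) ?_
    refine add_mem (add_mem (add_mem (add_mem (add_mem (add_mem (add_mem (add_mem (add_mem
      (add_mem (add_mem ?_ ?_) ?_) ?_) ?_) ?_) ?_) ?_) ?_) ?_) ?_) ?_ <;>
    exact hs _ _ (by decide) _

/-! ### Subtracting positive operators -/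

theorem expectation_sub {ι : Type*} [Fintype ι] (M N : Matrix ι ι ℂ) (v : ι → ℂ) :
    expectation (M - N) v = expectation M v - expectation N v := by
  simp [expectation, Matrix.sub_mulVec]

theorem expectation_smul {ι : Type*} [Fintype ι] (c : ℂ) (M : Matrix ι ι ℂ) (v : ι → ℂ) :
    expectation (c • M) v = c * expectation M v := by
  simp [expectation, Matrix.smul_mulVec]

theorem Matrix.IsHermitian.expectation_add_of_mulVec_eq_zero {ι : Type*} [Fintype ι]
    {P : Matrix ι ι ℂ} (hP : P.IsHermitian) {u : ι → ℂ} (hu : P.mulVec u = 0) (r : ι → ℂ) :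
    expectation P (u + r) = expectation P r := by
  have h : star u ⬝ᵥ P.mulVec r = 0 := by
    rw [Matrix.dotProduct_mulVec, ← hP.eq, ← Matrix.star_mulVec, hu]; simp
  simp [expectation, Matrix.mulVec_add, hu, add_dotProduct, h]

theorem Matrix.IsHermitian.expectation_single_add_single {ι : Type*} [Fintype ι] [DecidableEq ι]
    {P : Matrix ι ι ℂ} (hP : P.IsHermitian) (i j : ι) (x y : ℝ) :
    (expectation P (Pi.single i (x : ℂ) + Pi.single j (y : ℂ))).re =
      x ^ 2 * (P i i).re + 2 * x * y * (P i j).re + y ^ 2 * (P j j).re := by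
  have h : (P j i).re = (P i j).re := by
    rw [← hP.apply i j, Complex.star_def, Complex.conj_re]
  have hs : star (Pi.single i (x : ℂ) + Pi.single j (y : ℂ)) =
      (Pi.single i (x : ℂ) + Pi.single j (y : ℂ) : ι → ℂ) := by
    rw [star_add, ← Pi.single_star, ← Pi.single_star]
    simp
  simp [expectation, hs, Matrix.mulVec_add, add_dotProduct, dotProduct_add, h]
  ring

theorem le_zero_of_forall_le_mul {p K δ₀ : ℝ} (hδ₀ : 0 < δ₀)
    (h : ∀ δ, 0 < δ → δ ≤ δ₀ → p ≤ K * δ) : p ≤ 0 := by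
  have ht : Filter.Tendsto (fun δ : ℝ => K * δ) (nhdsWithin 0 (Set.Ioi 0)) (nhds 0) := by
    have : ContinuousAt (fun δ : ℝ => K * δ) 0 := by fun_prop
    simpa [ContinuousAt] using this.tendsto.mono_left nhdsWithin_le_nhds
  refine ge_of_tendsto ht ?_
  filter_upwards [Ioc_mem_nhdsGT hδ₀] with δ hδ using h δ hδ.1 hδ.2

/-- Product vectors with expectation value of third order whose deviation from the subspace of
zeros is of first order in a single direction. -/
theorem exists_productVector_expectation_le {a S κ δ : ℝ} (hSa : S ^ 2 = a * (1 - a))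
    (hκ : 0 < κ) (hκS : κ * S = a) (hS : S ≠ 0) (hδ : 0 < δ) (hδκ : δ * (1 + κ) ≤ 1 / 2) :
    ∃ (ψ φ : Fin 4 → ℂ) (z : ℝ), |z| ≤ 2 * κ * δ ^ 2 ∧
      ψ 0 * φ 0 - ψ 2 * φ 2 = z ∧ ψ 1 * φ 1 - ψ 3 * φ 3 = δ ∧
      (expectation (circulantOperator a (1 - S) (1 - a) (1 + S)) (productVector ψ φ)).re ≤
        2 * κ ^ 2 * δ ^ 3 := by
  -- For the y below, s + t = 1, t = v = δ and u = -e. The choice κ = a / S makes n = 0 and m = -e,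
  -- so the defect identity retains only m² t (s + t) = e² δ, of third order.
  set e : ℝ := κ * δ with he
  have he0 : 0 < e := mul_pos hκ hδ
  have hsum : δ + e ≤ 1 / 2 := by rw [he]; linarith
  have hS1 : S + κ * a = κ := by
    apply mul_right_cancel₀ hS
    linear_combination hSa + (a - 1) * hκS
  let y : Fin 4 → ℝ := ![(1 - δ - e) / 2, δ, (1 - δ + e) / 2, 0]
  let w : Fin 4 → ℝ := ![1 - e, 1, 1 + e, 1]
  have hy : ∀ k, 0 ≤ y k := by
    intro k
    fin_cases k <;> simp [y] <;> linarith
  have hw : ∀ k, 0 < w k := by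
    intro k
    fin_cases k <;> simp [w] <;> linarith
  have hyw : ∀ k, cyclicWeight a S y k = w k := by
    have h1 : a * e + S * δ = e := by rw [he]; linear_combination δ * hS1
    have h2 : a * δ - S * e = 0 := by rw [he]; linear_combination -δ * hκS
    intro k
    fin_cases k
    · exact (cyclicWeight_zero _ _ _).trans (by simp [y, w]; linear_combination -h1)
    · exact (cyclicWeight_one _ _ _).trans (by simp [y, w]; linear_combination h2)
    · exact (cyclicWeight_two _ _ _).trans (by simp [y, w]; linear_combination h1)
    · exact (cyclicWeight_three _ _ _).trans (by simp [y, w]; linear_combination -h2)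
  have hm : ∀ k, (((√(y k) / w k : ℝ) : ℂ)) * ((√(y k) : ℝ) : ℂ) = ((y k / w k : ℝ) : ℂ) :=
    fun k => by
      rw [← Complex.ofReal_mul, div_mul_eq_mul_div, Real.mul_self_sqrt (hy k)]
  have he2 : 1 / 2 ≤ 1 - e ^ 2 := by nlinarith
  have hw0 : (1 - e) ≠ 0 := by linarith
  have hw2 : (1 + e) ≠ 0 := by linarith
  have hq : 1 - e ^ 2 ≠ 0 := by linarith
  -- Equality case of the weighted Cauchy–Schwarz inequality: ψ_k w_k = φ_k. With G = ∑ y_k / w_k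
  -- the expectation value is G - G² ≤ 1 - G.
  refine ⟨fun k => ((√(y k) / w k : ℝ) : ℂ), fun k => ((√(y k) : ℝ) : ℂ),
    -(e * δ) / (1 - e ^ 2), ?_, ?_, ?_, ?_⟩
  · rw [abs_div, abs_neg, abs_of_pos (mul_pos he0 hδ), abs_of_pos (by linarith),
      div_le_iff₀ (by linarith)]
    have : 0 ≤ κ * δ ^ 2 := by positivity
    rw [he] at he2 ⊢
    nlinarith
  · simp only [hm]
    rw [← Complex.ofReal_sub]
    congr 1
    simp only [y, w, Matrix.cons_val_zero, Matrix.cons_val]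
    field_simp
    ring
  · simp only [hm]
    rw [← Complex.ofReal_sub]
    congr 1
    simp [y, w]
  · have hn : (fun l => Complex.normSq ((√(y l) : ℝ) : ℂ)) = y := funext fun l => by
      rw [Complex.normSq_ofReal, Real.mul_self_sqrt (hy l)]
    have hG : ∑ k, y k / w k = 1 - δ * e ^ 2 / (1 - e ^ 2) := by
      simp only [Fin.sum_univ_four, y, w, Matrix.cons_val_zero, Matrix.cons_val_one,
        Matrix.cons_val]
      field_simp
      ring
    have hG0 : 0 ≤ ∑ k, y k / w k := Finset.sum_nonneg fun k _ => div_nonneg (hy k) (hw k).le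
    rw [expectation_productVector, Complex.ofReal_re, hn]
    simp only [hm, hyw]
    rw [← Complex.ofReal_sum, Complex.normSq_ofReal]
    have h1 : ∑ k, Complex.normSq ((√(y k) / w k : ℝ) : ℂ) * w k = ∑ k, y k / w k := by
      refine Finset.sum_congr rfl fun k _ => ?_
      have := (hw k).ne'
      rw [Complex.normSq_ofReal, div_mul_div_comm, Real.mul_self_sqrt (hy k)]
      field_simp
    rw [h1]
    have hD : δ * e ^ 2 / (1 - e ^ 2) ≤ 2 * κ ^ 2 * δ ^ 3 := by
      rw [div_le_iff₀ (by linarith)]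
      have : 0 ≤ κ ^ 2 * δ ^ 3 := by positivity
      rw [he] at he2 ⊢
      nlinarith
    have hD0 : 0 ≤ δ * e ^ 2 / (1 - e ^ 2) := div_nonneg (by positivity) (by linarith)
    nlinarith

/-- At a zero of W, nonnegativity of W - P forces ⟨v|P|v⟩ ≤ 0, hence P v = 0 by positivity of P; the
kernel is a subspace. -/
theorem Matrix.PosSemidef.mulVec_eq_zero_of_blockPositive_sub {m n : Type*} [Fintype m] [Fintype n]
    {W P : Matrix (m × n) (m × n) ℂ} (hP : P.PosSemidef)
    (h : ∀ ψ φ, 0 ≤ (expectation (W - P) (productVector ψ φ)).re) {v : m × n → ℂ}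
    (hv : v ∈ Submodule.span ℂ (zeroProductVectors W)) : P.mulVec v = 0 := by
  have hle : Submodule.span ℂ (zeroProductVectors W) ≤ LinearMap.ker P.mulVecLin := by
    rw [Submodule.span_le]
    rintro _ ⟨ψ, φ, rfl, h0⟩
    rw [SetLike.mem_coe, LinearMap.mem_ker, Matrix.mulVecLin_apply,
      ← hP.dotProduct_mulVec_zero_iff]
    have h1 := hP.dotProduct_mulVec_nonneg (productVector ψ φ)
    have h2 := h ψ φ
    rw [expectation_sub, h0, zero_sub, Complex.neg_re] at h2
    obtain ⟨h3, h4⟩ := Complex.nonneg_iff.1 h1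
    exact Complex.ext (le_antisymm (by simpa [expectation] using h2) h3) h4.symm
  exact hle hv

theorem sub_single_sub_single_mem_ker_diagonalDefect (v : Fin 4 × Fin 4 → ℂ) :
    v - (Pi.single (0, 0) (v (0, 0) - v (2, 2)) + Pi.single (1, 1) (v (1, 1) - v (3, 3))) ∈
      LinearMap.ker diagonalDefect := by
  rw [mem_ker_diagonalDefect]
  simp

theorem Matrix.PosSemidef.diagonal_eq_zero_of_blockPositive_sub {a S : ℝ} (ha : 0 < a)
    (ha1 : a < 1) (hS : 0 < S) (hS1 : S < 1) (hSa : S ^ 2 = a * (1 - a))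
    {P : Matrix (Fin 4 × Fin 4) (Fin 4 × Fin 4) ℂ} (hP : P.PosSemidef)
    (h : ∀ ψ φ, 0 ≤
      (expectation (circulantOperator a (1 - S) (1 - a) (1 + S) - P) (productVector ψ φ)).re) :
    P (1, 1) (1, 1) = 0 := by
  obtain ⟨h3, h4⟩ := Complex.nonneg_iff.1 (hP.diag_nonneg (i := (1, 1)))
  refine Complex.ext (le_antisymm ?_ h3) h4.symm
  have h00 := (Complex.nonneg_iff.1 (hP.diag_nonneg (i := (0, 0)))).1
  have hκ : 0 < a / S := div_pos ha hS
  have hκS : a / S * S = a := div_mul_cancel₀ _ hS.ne'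
  generalize a / S = κ at hκ hκS
  rw [Complex.zero_re]
  -- After division by δ², the first summand of `K` comes from the expectation value of W, the
  -- second from the cross term 2 z δ Re P_{00,11} with |z| ≤ 2κδ². The z² term is nonnegative and
  -- is dropped.
  refine le_zero_of_forall_le_mul (δ₀ := 1 / (2 * (1 + κ)))
    (K := 2 * κ ^ 2 + 4 * κ * |(P (0, 0) (1, 1)).re|) (by positivity) fun δ hδ hδ₀ => ?_
  obtain ⟨ψ, φ, z, hz, e0, e1, hE⟩ := exists_productVector_expectation_le hSa hκ hκS hS.ne' hδ
    (by rw [le_div_iff₀ (by positivity)] at hδ₀; linarith)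
  have hv := sub_single_sub_single_mem_ker_diagonalDefect (productVector ψ φ)
  rw [← span_zeroProductVectors ha ha1 hS hS1 hSa] at hv
  have hk := hP.mulVec_eq_zero_of_blockPositive_sub h hv
  have hx := hP.isHermitian.expectation_add_of_mulVec_eq_zero hk
    (Pi.single (0, 0) (productVector ψ φ (0, 0) - productVector ψ φ (2, 2)) +
      Pi.single (1, 1) (productVector ψ φ (1, 1) - productVector ψ φ (3, 3)))
  rw [sub_add_cancel] at hx
  simp only [productVector] at hx
  rw [e0, e1] at hx
  have hb := h ψ φ
  rw [expectation_sub, Complex.sub_re] at hb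
  have hb' : (expectation P (productVector ψ φ)).re ≤ 2 * κ ^ 2 * δ ^ 3 := by linarith
  rw [hx, hP.isHermitian.expectation_single_add_single] at hb'
  have hc : -(2 * κ * δ ^ 2 * |(P (0, 0) (1, 1)).re|) ≤ z * (P (0, 0) (1, 1)).re := by
    have := neg_abs_le (z * (P (0, 0) (1, 1)).re)
    rw [abs_mul] at this
    have := mul_le_mul_of_nonneg_right hz (abs_nonneg (P (0, 0) (1, 1)).re)
    linarith
  have hz0 : 0 ≤ z ^ 2 * (P (0, 0) (0, 0)).re := mul_nonneg (sq_nonneg _) h00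
  have hc' := mul_le_mul_of_nonneg_left hc hδ.le
  refine le_of_mul_le_mul_left ?_ (pow_pos hδ 2)
  linarith

theorem expectation_submatrix_equiv {ι κ : Type*} [Fintype ι] [Fintype κ] (M : Matrix κ κ ℂ)
    (e : ι ≃ κ) (v : ι → ℂ) :
    expectation (M.submatrix e e) v = expectation M (v ∘ e.symm) := by
  simp only [expectation, dotProduct, Matrix.mulVec, Matrix.submatrix_apply, Pi.star_apply,
    Function.comp_apply]
  rw [← Equiv.sum_comp e]
  refine Finset.sum_congr rfl fun i _ => ?_
  rw [← Equiv.sum_comp e]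
  simp

/-- Simultaneous cyclic shifts of both factors preserve the operator, which transfers the vanishing
at (1, 1) to (0, 0). -/
theorem circulantOperator_submatrix_addRight (a b c d : ℝ) (j : Fin 4) :
    (circulantOperator a b c d).submatrix
      ((Equiv.addRight j).prodCongr (Equiv.addRight j))
      ((Equiv.addRight j).prodCongr (Equiv.addRight j)) = circulantOperator a b c d := by
  have hA : ∀ k l, circulantA a b c d (k + j) (l + j) = circulantA a b c d k l := by
    intro k l
    fin_cases j <;> fin_cases k <;> fin_cases l <;> rfl
  ext p q
  simp only [Matrix.submatrix_apply, circulantOperator_apply, EmbeddingLike.apply_eq_iff_eq]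
  simp [hA]

/-- No nonzero positive operator can be subtracted without losing positivity on product vectors. -/
theorem Matrix.PosSemidef.eq_zero_of_blockPositive_sub {a S : ℝ} (ha : 0 < a)
    (ha1 : a < 1) (hS : 0 < S) (hS1 : S < 1) (hSa : S ^ 2 = a * (1 - a))
    {P : Matrix (Fin 4 × Fin 4) (Fin 4 × Fin 4) ℂ} (hP : P.PosSemidef)
    (h : ∀ ψ φ, 0 ≤
      (expectation (circulantOperator a (1 - S) (1 - a) (1 + S) - P) (productVector ψ φ)).re) :
    P = 0 := by
  have h11 := hP.diagonal_eq_zero_of_blockPositive_sub ha ha1 hS hS1 hSa h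
  have h00 : P (0, 0) (0, 0) = 0 := by
    -- The shift by 3 is used because 1 + 3 = 0 in `Fin 4`.
    refine (hP.submatrix ((Equiv.addRight (3 : Fin 4)).prodCongr
      (Equiv.addRight 3))).diagonal_eq_zero_of_blockPositive_sub ha ha1 hS hS1 hSa fun ψ φ => ?_
    rw [← circulantOperator_submatrix_addRight _ _ _ _ 3]
    have := expectation_submatrix_equiv (circulantOperator a (1 - S) (1 - a) (1 + S) - P)
      ((Equiv.addRight (3 : Fin 4)).prodCongr (Equiv.addRight 3)) (productVector ψ φ)
    rw [Matrix.submatrix_sub] at this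
    exact this ▸ h (ψ ∘ (Equiv.addRight 3).symm) (φ ∘ (Equiv.addRight 3).symm)
  have hs : ∀ i c, P i i = 0 → P.mulVec (Pi.single i c) = 0 := by
    intro i c hi
    rw [← hP.dotProduct_mulVec_zero_iff]
    simp [hi]
  refine Matrix.ext_of_mulVec_single fun i => ?_
  have hv := sub_single_sub_single_mem_ker_diagonalDefect (Pi.single i 1)
  rw [← span_zeroProductVectors ha ha1 hS hS1 hSa] at hv
  have hk := hP.mulVec_eq_zero_of_blockPositive_sub h hv
  rw [Matrix.mulVec_sub, Matrix.mulVec_add, hs _ _ h00, hs _ _ h11, add_zero, sub_zero] at hk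
  rw [hk, Matrix.zero_mulVec]

/-! ### Comparing the states detected by two witnesses -/

/-- The constant is the infimum of g / f over the points with f < 0. The cross inequality says that
each such ratio dominates g / f at every point with f > 0, and that g ≤ 0 where f = 0. -/
theorem exists_nonneg_forall_le_mul {E : Type*} {K : Set E} {f g : E → ℝ}
    (h0 : ∃ x ∈ K, f x < 0) (hneg : ∀ x ∈ K, f x < 0 → g x < 0)
    (h : ∀ x ∈ K, ∀ y ∈ K, f x < 0 → 0 ≤ f y → f y * g x ≤ f x * g y) :
    ∃ c, 0 ≤ c ∧ ∀ x ∈ K, g x ≤ c * f x := by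
  let T : Set ℝ := {r | ∃ x ∈ K, f x < 0 ∧ r = g x / f x}
  have hT0 : ∀ r ∈ T, 0 ≤ r := by
    rintro r ⟨x, hx, hf, rfl⟩
    exact (div_pos_of_neg_of_neg (hneg x hx hf) hf).le
  have hTb : BddBelow T := ⟨0, fun r hr => hT0 r hr⟩
  obtain ⟨x₀, hx₀, hf₀⟩ := h0
  have hTn : T.Nonempty := ⟨_, x₀, hx₀, hf₀, rfl⟩
  refine ⟨sInf T, le_csInf hTn hT0, fun y hy => ?_⟩
  rcases lt_trichotomy (f y) 0 with hf | hf | hf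
  · exact (le_div_iff_of_neg hf).1 (csInf_le hTb ⟨y, hy, hf, rfl⟩)
  · have := h x₀ hx₀ y hy hf₀ hf.ge
    rw [hf, zero_mul] at this
    rw [hf, mul_zero]
    by_contra! hg
    nlinarith
  · rw [← div_le_iff₀ hf]
    refine le_csInf hTn ?_
    rintro r ⟨x, hx, hfx, rfl⟩
    rw [div_le_iff₀ hf, div_mul_eq_mul_div, le_div_iff_of_neg hfx]
    linarith [h x hx y hy hfx hf.le]

theorem trace_mul_vecMulVec_star {ι : Type*} [Fintype ι] (W : Matrix ι ι ℂ) (v : ι → ℂ) :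
    (W * Matrix.vecMulVec v (star v)).trace = expectation W v := by
  rw [Matrix.mul_vecMulVec, Matrix.trace_vecMulVec, dotProduct_comm, expectation]

theorem Matrix.PosSemidef.trace_mul_neg_of_detectedStates_subset {ι : Type*} [Fintype ι]
    {W W' ρ : Matrix ι ι ℂ} (h : detectedStates W ⊆ detectedStates W') (hρ : ρ.PosSemidef)
    (hW : (W * ρ).trace.re < 0) : (W' * ρ).trace.re < 0 := by
  obtain ⟨h1, h2⟩ := Complex.nonneg_iff.1 hρ.trace_nonneg
  have ht : ρ.trace = (ρ.trace.re : ℂ) := Complex.ext rfl h2.symm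
  have hpos : 0 < ρ.trace.re := by
    refine lt_of_le_of_ne h1 fun h0 => ?_
    rw [← h0, Complex.ofReal_zero] at ht
    rw [hρ.trace_eq_zero_iff.1 ht] at hW
    simp at hW
  have hs : ∀ M : Matrix ι ι ℂ, (M * (((ρ.trace.re)⁻¹ : ℝ) : ℂ) • ρ).trace.re =
      (ρ.trace.re)⁻¹ * (M * ρ).trace.re := by
    intro M
    rw [Matrix.mul_smul, Matrix.trace_smul, smul_eq_mul, Complex.re_ofReal_mul]
  have hd : (((ρ.trace.re)⁻¹ : ℝ) : ℂ) • ρ ∈ detectedStates W := by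
    refine ⟨⟨hρ.smul (Complex.zero_le_real.2 (inv_pos.2 hpos).le), ?_⟩, ?_⟩
    · rw [Matrix.trace_smul, smul_eq_mul]
      nth_rewrite 2 [ht]
      rw [← Complex.ofReal_mul, inv_mul_cancel₀ hpos.ne', Complex.ofReal_one]
    · rw [hs]
      exact mul_neg_of_pos_of_neg (inv_pos.2 hpos) hW
  have h3 := (h hd).2
  rw [hs] at h3
  exact (pos_iff_neg_of_mul_neg h3).1 (inv_pos.2 hpos)

theorem Matrix.IsHermitian.posSemidef_of_expectation_re_nonneg {ι : Type*} [Fintype ι]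
    {M : Matrix ι ι ℂ} (hM : M.IsHermitian) (h : ∀ v, 0 ≤ (expectation M v).re) :
    M.PosSemidef :=
  .of_dotProduct_mulVec_nonneg hM fun v =>
    Complex.nonneg_iff.2 ⟨h v, (hM.im_star_dotProduct_mulVec_self v).symm⟩

/-- If `W'` detects every state detected by `W`, then `W` is, up to a positive factor on `W'`,
the sum of `W'` and a positive operator. -/
theorem exists_smul_sub_posSemidef_of_detectedStates_subset {m n : Type*} [Fintype m] [Fintype n]
    {W W' : Matrix (m × n) (m × n) ℂ} (hW : W.IsHermitian) (hW0 : ¬ W.PosSemidef)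
    (hW' : IsEntanglementWitness W') (h : detectedStates W ⊆ detectedStates W') :
    ∃ c : ℝ, 0 < c ∧ ((c : ℂ) • W - W').PosSemidef := by
  classical
  have hneg : ∀ ρ ∈ {ρ : Matrix (m × n) (m × n) ℂ | ρ.PosSemidef},
      (W * ρ).trace.re < 0 → (W' * ρ).trace.re < 0 := fun ρ hρ =>
    Matrix.PosSemidef.trace_mul_neg_of_detectedStates_subset h hρ
  obtain ⟨c, hc0, hc⟩ := exists_nonneg_forall_le_mul
    (K := {ρ : Matrix (m × n) (m × n) ℂ | ρ.PosSemidef})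
    (f := fun ρ => (W * ρ).trace.re) (g := fun ρ => (W' * ρ).trace.re) (by
      by_contra! hn
      refine hW0 (hW.posSemidef_of_expectation_re_nonneg fun v => ?_)
      rw [← trace_mul_vecMulVec_star]
      exact hn _ (Matrix.posSemidef_vecMulVec_self_star v)) hneg (by
      intro x hx y hy hfx hfy
      have hgx := hneg x hx hfx
      by_contra! hlt
      set f := fun ρ : Matrix (m × n) (m × n) ℂ => (W * ρ).trace.re
      set g := fun ρ : Matrix (m × n) (m × n) ℂ => (W' * ρ).trace.re
      change f x < 0 at hfx
      change g x < 0 at hgx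
      change 0 ≤ f y at hfy
      change f x * g y < f y * g x at hlt
      -- The mixture (f y + ε) x + (-f x) y has f-value ε f x < 0, so its g-value must be negative;
      -- this ε makes that g-value exactly zero.
      set ε := (f y * g x - f x * g y) / (-g x)
      have hε0 : 0 < ε := div_pos (by linarith) (by linarith)
      have hlin : ∀ M : Matrix (m × n) (m × n) ℂ,
          (M * (((f y + ε : ℝ) : ℂ) • x + ((-f x : ℝ) : ℂ) • y)).trace.re =
          (f y + ε) * (M * x).trace.re + -f x * (M * y).trace.re := by
        intro M
        rw [Matrix.mul_add, Matrix.mul_smul, Matrix.mul_smul, Matrix.trace_add, Matrix.trace_smul,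
          Matrix.trace_smul, smul_eq_mul, smul_eq_mul, Complex.add_re, Complex.re_ofReal_mul,
          Complex.re_ofReal_mul]
      have hps : (((f y + ε : ℝ) : ℂ) • x + ((-f x : ℝ) : ℂ) • y).PosSemidef :=
        (Matrix.PosSemidef.smul hx (Complex.zero_le_real.2 (by linarith))).add
          (Matrix.PosSemidef.smul hy (Complex.zero_le_real.2 (by linarith)))
      have h1 := hneg _ hps (by
        rw [hlin]
        change (f y + ε) * f x + -f x * f y < 0
        have := mul_neg_of_pos_of_neg hε0 hfx
        linarith)
      rw [hlin] at h1
      change (f y + ε) * g x + -f x * g y < 0 at h1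
      have h2 : ε * (-g x) = f y * g x - f x * g y :=
        div_mul_cancel₀ _ (by linarith)
      linarith)
  have hH : ((c : ℂ) • W - W').IsHermitian := by
    have : ((c : ℂ) • W).IsHermitian := by
      rw [Matrix.IsHermitian, Matrix.conjTranspose_smul, hW.eq, Complex.star_def,
        Complex.conj_ofReal]
    exact this.sub hW'.1
  have hps : ((c : ℂ) • W - W').PosSemidef := by
    refine hH.posSemidef_of_expectation_re_nonneg fun v => ?_
    have := hc _ (Matrix.posSemidef_vecMulVec_self_star v)
    simp only [trace_mul_vecMulVec_star] at this
    rw [expectation_sub, expectation_smul, Complex.sub_re, Complex.re_ofReal_mul]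
    linarith
  -- If c = 0, then -W' ≥ 0. Every product vector is a zero of the operator 0, and 0 - (-W') is
  -- nonnegative on product vectors, so W' kills all basis vectors and vanishes, contradicting that
  -- W' is not positive semidefinite.
  refine ⟨c, lt_of_le_of_ne hc0 fun h0 => hW'.2.2 ?_, hps⟩
  rw [← h0, Complex.ofReal_zero, zero_smul] at hps
  have hz : W' = 0 := by
    refine Matrix.ext_of_mulVec_single fun p => ?_
    have hp : (Pi.single p 1 : m × n → ℂ) =
        productVector (Pi.single p.1 1) (Pi.single p.2 1) := by
      ext q
      by_cases h1 : q.1 = p.1 <;> by_cases h2 : q.2 = p.2 <;>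
        simp [productVector, Pi.single_apply, Prod.ext_iff, h1, h2]
    have hk := hps.mulVec_eq_zero_of_blockPositive_sub (W := 0) (by simpa using hW'.2.1)
      (v := Pi.single p 1) (Submodule.subset_span ⟨_, _, hp, by simp [expectation]⟩)
    rw [Matrix.sub_mulVec, Matrix.zero_mulVec, zero_sub, neg_eq_zero] at hk
    rw [hk, Matrix.zero_mulVec]
  rw [hz]
  exact .zero

/-! ### The class-II witnesses -/

theorem circulantOperator_isHermitian (a b c d : ℝ) : (circulantOperator a b c d).IsHermitian := by
  ext p q
  rw [Matrix.conjTranspose_apply, circulantOperator_apply, circulantOperator_apply]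
  by_cases hpq : p = q
  · subst hpq
    by_cases hp : p.1 = p.2 <;> simp [hp]
  · rw [if_neg hpq, if_neg (Ne.symm hpq), zero_sub, zero_sub]
    by_cases hp : p.1 = p.2 <;> by_cases hq : q.1 = q.2 <;> simp [hp, hq]

theorem circulantOperator_not_posSemidef {a b c d : ℝ} (ha : a < 3) :
    ¬ (circulantOperator a b c d).PosSemidef := by
  intro h
  -- The maximally entangled vector ∑ |kk⟩ has expectation value 4a + 4 - 16.
  have h1 := (Complex.nonneg_iff.1
    (h.dotProduct_mulVec_nonneg (fun p => if p.1 = p.2 then 1 else 0))).1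
  change 0 ≤ (expectation _ _).re at h1
  rw [expectation_circulantOperator, Complex.ofReal_re] at h1
  simp [Fin.sum_univ_four, circulantA, Complex.normSq_apply] at h1
  linarith

theorem circulantOperator_isEntanglementWitness {a S : ℝ} (ha : 0 < a) (ha1 : a < 1) (hS : 0 < S)
    (hS1 : S < 1) (hSa : S ^ 2 = a * (1 - a)) :
    IsEntanglementWitness (circulantOperator a (1 - S) (1 - a) (1 + S)) :=
  ⟨circulantOperator_isHermitian _ _ _ _,
    expectation_productVector_nonneg ha ha1 hS hS1 hSa,
    circulantOperator_not_posSemidef (by linarith)⟩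

theorem circulantOperator_isOptimalEntanglementWitness {a S : ℝ} (ha : 0 < a) (ha1 : a < 1)
    (hS : 0 < S) (hS1 : S < 1) (hSa : S ^ 2 = a * (1 - a)) :
    IsOptimalEntanglementWitness (circulantOperator a (1 - S) (1 - a) (1 + S)) := by
  have hEW := circulantOperator_isEntanglementWitness ha ha1 hS hS1 hSa
  refine ⟨hEW, fun W' hW' hss => ?_⟩
  obtain ⟨c, hc, hP⟩ :=
    exists_smul_sub_posSemidef_of_detectedStates_subset hEW.1 hEW.2.2 hW' hss.subset
  have hcC : (c : ℂ) ≠ 0 := Complex.ofReal_ne_zero.2 hc.ne'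
  have hP' := hP.smul (Complex.zero_le_real.2 (inv_pos.2 hc).le)
  rw [smul_sub, smul_smul, Complex.ofReal_inv, inv_mul_cancel₀ hcC, one_smul] at hP'
  have h0 := hP'.eq_zero_of_blockPositive_sub ha ha1 hS hS1 hSa fun ψ φ => by
    rw [sub_sub_cancel, expectation_smul, ← Complex.ofReal_inv, Complex.re_ofReal_mul]
    exact mul_nonneg (inv_pos.2 hc).le (hW'.2.1 ψ φ)
  -- Here W = W'/c, so both operators detect the same states.
  refine hss.not_subset fun ρ hρ => ⟨hρ.1, ?_⟩
  rw [sub_eq_zero.1 h0, Matrix.smul_mul, Matrix.trace_smul, smul_eq_mul, ← Complex.ofReal_inv,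
    Complex.re_ofReal_mul]
  exact mul_neg_of_pos_of_neg (inv_pos.2 hc) hρ.2

theorem classIIWitness_eq_circulantOperator (θ : ℝ) :
    classIIWitness θ = circulantOperator ((1 + Real.cos θ) / 2) (1 - Real.sin θ / 2)
      (1 - (1 + Real.cos θ) / 2) (1 + Real.sin θ / 2) := by
  unfold classIIWitness
  congr 1 <;> ring

theorem theorem2 (θ : ℝ) (hθ : θ ∈ Set.Ioo 0 Real.pi) :
    IsOptimalEntanglementWitness (classIIWitness θ) ∧
    Module.finrank ℂ (Submodule.span ℂ (zeroProductVectors (classIIWitness θ))) = 14 ∧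
    ¬ HasSpanningProperty (classIIWitness θ) ∧
    ∀ P : Matrix (Fin 4 × Fin 4) (Fin 4 × Fin 4) ℂ, P.PosSemidef → P ≠ 0 →
      ¬ IsEntanglementWitness (classIIWitness θ - P) := by
  have hsin : 0 < Real.sin θ := Real.sin_pos_of_mem_Ioo hθ
  have hsc := Real.sin_sq_add_cos_sq θ
  have ha : 0 < (1 + Real.cos θ) / 2 := by nlinarith
  have ha1 : (1 + Real.cos θ) / 2 < 1 := by nlinarith
  have hS : 0 < Real.sin θ / 2 := by linarith
  have hS1 : Real.sin θ / 2 < 1 := by linarith [Real.sin_le_one θ]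
  have hSa : (Real.sin θ / 2) ^ 2 = (1 + Real.cos θ) / 2 * (1 - (1 + Real.cos θ) / 2) := by
    linear_combination hsc / 4
  have hrank : Module.finrank ℂ (Submodule.span ℂ (zeroProductVectors (classIIWitness θ))) = 14 := by
    rw [classIIWitness_eq_circulantOperator, span_zeroProductVectors ha ha1 hS hS1 hSa,
      finrank_ker_diagonalDefect]
  refine ⟨?_, hrank, fun hsp => ?_, fun P hP hP0 hEW => hP0 ?_⟩
  · rw [classIIWitness_eq_circulantOperator]
    exact circulantOperator_isOptimalEntanglementWitness ha ha1 hS hS1 hSa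
  · rw [HasSpanningProperty] at hsp
    rw [hsp, finrank_top] at hrank
    simp at hrank
  · rw [classIIWitness_eq_circulantOperator] at hEW
    exact hP.eq_zero_of_blockPositive_sub ha ha1 hS hS1 hSa hEW.2.1
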